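/- Let $R$ be a root system of type $E_6$ or $E_7$ with set of simple roots $S=\{\alpha_1,\dots,\alpha_n\}$, positive roots $R^+$ and Weyl group $W$, with simple reflections $s_\alpha$ ($\alpha\in S$). For weights $\lambda,\mu$ write $\lambda\ge\mu$ if $\lambda-\mu$ is a linear combination of simple roots with nonnegative integer coefficients. Let $I\subseteq S$ be such that the parabolic subgroup $P_I$ is minuscule, i.e. the sum $\varpi$ of the fundamental weights of the simple roots in $S\setminus I$ satisfies $\langle\varpi,\beta^\vee\rangle\le 1$ for all $\beta\in R^+$. Let $w\ne 1$ be an element of $W^I=\{w\in W : w(\beta)\in R^+ \text{ for all } \beta\in I\}$, with a reduced decomposition $w=s_{\beta_1}\cdots s_{\beta_k}$. The quiver $Q_w$ has vertices $1,\dots,k$, and an arrow $i\to j$ whenever $\langle\beta_j^\vee,\beta_i\rangle\neq0$, $i<j$, and no vertex $l$ with $i<l\le j$ has $\beta_l=\beta_i$. For a full subquiver $Q$ of $Q_w$, the arrows of $Q$ generate a partial order $\preceq$ on its vertices ($i\preceq j$ if there is a possibly trivial path from $i$ to $j$); the peaks of $Q$ are its minimal vertices. For a set $A$ of peaks of $Q$,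 let $Q(A)$ be the full subquiver on the vertices $i$ of $Q$ such that $j\not\preceq i$ for all peaks $j\notin A$ of $Q$. Given any ordering $(i_1,\dots,i_m)$ of the peaks of $Q_w$, construction 1 sets $Q_0=Q_w$ and, for $1\le j\le m$, lets $Q_j$ be the full subquiver obtained from $Q_{j-1}$ by removing the vertices of $Q_{j-1}(\{i_j\})$, and $w_j$ be the product of the $s_{\beta_i}$ over the vertices $i$ of $Q_{j-1}(\{i_j\})$, in increasing order. Let $\hat w=(w_1,\dots,w_m)$ be the resulting sequence. Then there is a unique simple root $\alpha$ such that $w_1^{-1}(\alpha)$ is a negative root. For this $\alpha$ we have $w_1^{-1}(\alpha)\ge w^{-1}(\alpha)$. Further, $w_1^{-1}(\alpha)=w^{-1}(\alpha)$ if and only if $w=w_1$; and $w=w_1$ if and only if $m=1$. (No smoothness assumption is made; in particular the statement applies whenever the generalised Bott–Samelson variety $\hat X(\hat w)$ is smooth.) -/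

import Mathlib

namespace MinusculeE

section RootSystems

variable {ι V V' : Type*} [AddCommGroup V] [Module ℚ V] [AddCommGroup V'] [Module ℚ V']
  {P : RootPairing ι ℚ V V'}

/-- The root system is of type `E₆`: for a suitable labelling of the simple roots, its Cartan
matrix is the one of type `E₆`. -/
def IsTypeE6 [P.IsCrystallographic] (b : P.Base) : Prop :=
  ∃ e : b.support ≃ Fin 6, ∀ i j, b.cartanMatrix i j = CartanMatrix.E₆ (e i) (e j)

/-- The root system is of type `E₇`. -/
def IsTypeE7 [P.IsCrystallographic] (b : P.Base) : Prop :=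
  ∃ e : b.support ≃ Fin 7, ∀ i j, b.cartanMatrix i j = CartanMatrix.E₇ (e i) (e j)

/-- The vector `v` is a positive root. -/
def IsPosRoot (b : P.Base) (v : V) : Prop :=
  ∃ i, b.IsPos i ∧ P.root i = v

/-- The vector `v` is a negative root. -/
def IsNegRoot (b : P.Base) (v : V) : Prop :=
  IsPosRoot b (-v)

/-- The order on weights: `Dominates b x y` means `x ≥ y`, that is, `x - y` is a linear
combination of simple roots with nonnegative integer coefficients. -/
def Dominates (b : P.Base) (x y : V) : Prop :=
  x - y ∈ AddSubmonoid.closure (P.root '' b.support)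

open Classical in
/-- The standard parabolic subgroup `P_I` attached to a set `I` of simple roots is minuscule: the
weight `ϖ`, the sum of the fundamental weights of the simple roots outside `I`, satisfies
`⟨ϖ, β^∨⟩ ≤ 1` for all positive roots `β`. -/
def IsMinusculeParabolic (b : P.Base) (I : Set b.support) : Prop :=
  ∃ ϖ : V, (∀ i : b.support, P.toLinearMap ϖ (P.coroot i) = if i ∈ I then 0 else 1) ∧
    ∀ i, b.IsPos i → P.toLinearMap ϖ (P.coroot i) ≤ 1

/-- The set `W^I` of Weyl group elements `w` such that `w(β)` is positive for all `β ∈ I`. -/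
def minimalReps (b : P.Base) (I : Set b.support) :
    Set P.weylGroup :=
  {w | ∀ i ∈ I, IsPosRoot b (w • P.root (i : ι))}

/-- The product of the simple reflections `s_{β i}`, for `i` in the set `Q` of positions of the
word `β`, taken in increasing order of the positions. -/
noncomputable def subwordProd (b : P.Base) {k : ℕ} (β : Fin k → b.support) (Q : Set (Fin k)) :
    P.weylGroup :=
  open Classical in
  (((List.finRange k).filter (fun i => i ∈ Q)).map
    (fun i => RootPairing.weylGroup.ofIdx P (β i : ι))).prod

/-- The product `s_{β 1} ⋯ s_{β k}` of the simple reflections of a word. -/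
noncomputable def wordProd (b : P.Base) {k : ℕ} (β : Fin k → b.support) : P.weylGroup :=
  ((List.finRange k).map (fun i => RootPairing.weylGroup.ofIdx P (β i : ι))).prod

/-- `β` is a reduced decomposition of `w`: a shortest word in the simple reflections with
product `w`. -/
def IsReducedDecomposition (b : P.Base) (w : P.weylGroup) {k : ℕ} (β : Fin k → b.support) :
    Prop :=
  wordProd b β = w ∧ ∀ (l : ℕ) (γ : Fin l → b.support), wordProd b γ = w → k ≤ l

/-- The arrows of the quiver of a word `β`: there is an arrow from `i` to `j` if
`⟨(β j)^∨, β i⟩ ≠ 0` and `i < j`, and `j < s(i)` in case the successor `s(i)` exists. The successor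
being the first position after `i` with the same label, the last condition says that no position
in `(i, j]` has the label `β i`. -/
def Arrow (b : P.Base) {k : ℕ} (β : Fin k → b.support) (i j : Fin k) : Prop :=
  P.pairing (β i) (β j) ≠ 0 ∧ i < j ∧ ∀ l, i < l → l ≤ j → β l ≠ β i

/-- The partial order on the vertices of the full subquiver with vertex set `Q`, generated by its
arrows; `QuiverLE b β Q i j` says that the pair `(i, j)` is in this order relation. -/
def QuiverLE (b : P.Base) {k : ℕ} (β : Fin k → b.support) (Q : Set (Fin k)) :
    Fin k → Fin k → Prop :=
  Relation.ReflTransGen (fun i j => i ∈ Q ∧ j ∈ Q ∧ Arrow b β i j)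

/-- The peaks of the full subquiver with vertex set `Q`: its minimal vertices. -/
def peaks (b : P.Base) {k : ℕ} (β : Fin k → b.support) (Q : Set (Fin k)) : Set (Fin k) :=
  {i | i ∈ Q ∧ ∀ j ∈ Q, QuiverLE b β Q j i → j = i}

/-- The vertex set of the quiver `Q(A)`, for a set `A` of peaks of `Q`: the vertices which are
not above any peak outside `A`. -/
def subquiver (b : P.Base) {k : ℕ} (β : Fin k → b.support) (Q A : Set (Fin k)) :
    Set (Fin k) :=
  {i | i ∈ Q ∧ ∀ j ∈ peaks b β Q \ A, ¬ QuiverLE b β Q j i}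

/-- Construction 1 applied to the full subquiver with vertex set `Q` and a list `i₁, …, iₘ` of its
peaks: the first factor is read off from `Q({i₁})`, and the others are obtained from the remaining
list and the quiver `Q` with the vertices of `Q({i₁})` removed. -/
noncomputable def constructionOneAux (b : P.Base) {k : ℕ} (β : Fin k → b.support) :
    Set (Fin k) → List (Fin k) → List P.weylGroup
  | _, [] => []
  | Q, i :: is =>
      subwordProd b β (subquiver b β Q {i}) ::
        constructionOneAux b β (Q \ subquiver b β Q {i}) is

/-- The sequence `(w₁, …, wₘ)` obtained by construction 1 from the quiver of the reduced
decomposition `β` and the given ordering of its peaks. -/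
noncomputable def constructionOne (b : P.Base) {k : ℕ} (β : Fin k → b.support)
    (order : List (Fin k)) : List P.weylGroup :=
  constructionOneAux b β Set.univ order

/-- The list `order` is an ordering of the set of peaks of the quiver of the word `β`. -/
def IsPeakOrdering (b : P.Base) {k : ℕ} (β : Fin k → b.support) (order : List (Fin k)) : Prop :=
  order.Nodup ∧ ∀ i, i ∈ order ↔ i ∈ peaks b β Set.univ

end RootSystems

end MinusculeE

/-!
Let `ϖ` be the weight defining the minuscule parabolic subgroup. It takes only the values `-1`, `0`
and `1` on coroots, and along a reduced word of `w ∈ W^I`, read from the right, every simple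
reflection lowers it by exactly one simple root (`lowers_of_mem_minimalReps`). Hence `wϖ` is `-1` on
all inversions of `w`, and two such roots never make an obtuse angle, since otherwise `wϖ` would be
at most `-2` on the reflection of one in the other (`IsMinuscule.pairing_nonneg`).

The set `Q` of vertices above the chosen peak `p` and above no other peak is an order ideal of the
quiver, because letters that do not commute are comparable (`quiverLE_of_lt`). So `w = w₁ w₂` for the
products `w₁` and `w₂` over `Q` and over its complement, and the two words together form a reduced
word of `w` (`reflProd_positions_mul`). Let `α` be the label of `p`.

* In the word of `w₁` every letter but the first is linked to an earlier one. Lowering `ϖ` along the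
  letters that precede the first occurrence of `γ ≠ α` therefore makes the value on `γ` nonnegative,
  so that `γ` is not a left descent of `w₁` (`eq_head_of_not_isPos`).
* Applying to `w₁⁻¹α` the letters of `w₂` one at a time subtracts the simple root of the letter with
  a coefficient which is the pairing of `α` with an inversion of `w`, hence nonnegative. This gives
  `w₁⁻¹α ≥ w⁻¹α`, and in case of equality `w₁⁻¹α` is orthogonal to all letters of `w₂`
  (`dominates_inv_smul`).
* The root `-w₁⁻¹α` is a nonnegative combination of exactly the letters of `w₁`
  (`coord_neg_inv_smul`), so it is strictly negative on any other simple coroot linked to one of them.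
  If it is orthogonal to the letters of `w₂`, then a letter of `w₂` linked to a letter of `w₁` is
  itself a letter of `w₁`. The maximal vertices of the quiver have labels outside `I`, and there is
  only one simple root outside `I`, as the sum of all simple coroots is a coroot (`eq_of_notMem`).
  If there were a second peak, one could pass along arrows from `p` up to a maximal vertex and from
  there down to that peak, and its label would be a letter of `w₁`. But vertices with equal labels
  are comparable, which contradicts the choice of `Q` (`subquiver_eq_univ`).
-/

namespace MinusculeE

open RootPairing

variable {ι V V' : Type*} [AddCommGroup V] [Module ℚ V] [AddCommGroup V'] [Module ℚ V']
  {P : RootPairing ι ℚ V V'}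


/-! ### The Weyl group action and the canonical form -/

theorem ofIdx_smul_eq (i : ι) (x : V) :
    weylGroup.ofIdx P i • x = x - P.toLinearMap x (P.coroot i) • P.root i := by
  rw [weylGroup.ofIdx_smul, Equiv.reflection_smul, reflection_apply]
  rfl

theorem smul_rat_smul (w : P.weylGroup) (c : ℚ) (x : V) : w • (c • x) = c • w • x := by
  obtain ⟨w, hw⟩ := w
  exact smul_comm w c x

/-- The Weyl group acts faithfully on the weight space. -/
theorem weylGroup_ext [P.IsRootSystem] {g h : P.weylGroup} (H : ∀ x : V, g • x = h • x) :
    g = h := by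
  apply Subtype.ext
  apply Equiv.weightHom_injective P
  ext x
  exact H x

theorem ofIdx_mul_self (i : ι) : weylGroup.ofIdx P i * weylGroup.ofIdx P i = 1 := by
  apply Subtype.ext
  change Equiv.reflection P i * Equiv.reflection P i = 1
  rw [mul_eq_one_iff_inv_eq, Equiv.reflection_inv P i]

theorem ofIdx_inv (i : ι) : (weylGroup.ofIdx P i)⁻¹ = weylGroup.ofIdx P i :=
  inv_eq_of_mul_eq_one_right (ofIdx_mul_self i)

/-- The value of a weight on a coroot, in terms of the canonical invariant form. -/
theorem two_mul_rootForm [Fintype ι] (x : V) (i : ι) :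
    2 * P.RootForm x (P.root i) =
      P.toLinearMap x (P.coroot i) * P.RootForm (P.root i) (P.root i) := by
  have h := P.rootForm_reflection_reflection_apply i x (P.root i)
  rw [reflection_apply_self, reflection_apply] at h
  simp only [map_sub, map_neg, LinearMap.sub_apply, map_smul, LinearMap.smul_apply,
    smul_eq_mul] at h
  change -(_ - P.toLinearMap x (P.coroot i) * _) = _ at h
  linarith

theorem rootForm_root_pos [Fintype ι] (i : ι) :
    0 < P.RootForm (P.root i) (P.root i) := by
  rw [rootForm_root_self]
  refine Finset.sum_pos' (fun j _ => mul_self_nonneg _) ⟨i, Finset.mem_univ _, ?_⟩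
  simp

theorem toLinearMap_smul_smul [Finite ι] (w : P.weylGroup) (x : V) (i : ι) :
    P.toLinearMap (w • x) (P.coroot (P.weylGroupToPerm w i)) = P.toLinearMap x (P.coroot i) := by
  let := Fintype.ofFinite ι
  let B := (P.posRootForm ℚ).toInvariantForm
  have hB : ∀ y z : V, P.RootForm (w • y) (w • z) = P.RootForm y z := fun y z =>
    InvariantForm.apply_weylGroup_smul P (B := B) w y z
  have h1 := two_mul_rootForm (P := P) (w • x) (P.weylGroupToPerm w i)
  rw [← weylGroup_apply_root, hB, hB] at h1
  have h2 := two_mul_rootForm (P := P) x i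
  exact mul_right_cancel₀ (rootForm_root_pos (P := P) i).ne' (h1.symm.trans h2)

theorem toLinearMap_inv_smul [Finite ι] (w : P.weylGroup) (x : V) (i : ι) :
    P.toLinearMap (w⁻¹ • x) (P.coroot i) =
      P.toLinearMap x (P.coroot (P.weylGroupToPerm w i)) := by
  rw [← toLinearMap_smul_smul w, smul_inv_smul]

/-- Reflections in the roots of a Weyl group orbit are conjugate. -/
theorem ofIdx_conj [Finite ι] [P.IsRootSystem] (w : P.weylGroup) (i : ι) :
    weylGroup.ofIdx P (P.weylGroupToPerm w i) = w * weylGroup.ofIdx P i * w⁻¹ := by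
  apply weylGroup_ext
  intro x
  rw [mul_smul, mul_smul, ofIdx_smul_eq, ofIdx_smul_eq, smul_sub, smul_inv_smul, smul_rat_smul,
    weylGroup_apply_root, toLinearMap_inv_smul]

/-! ### Positive roots and coordinates in the basis of simple roots -/

variable {b : P.Base}

theorem isPosRoot_root_iff [P.IsRootSystem] (i : ι) : IsPosRoot b (P.root i) ↔ b.IsPos i := by
  refine ⟨fun ⟨j, hj, h⟩ => ?_, fun h => ⟨i, h, rfl⟩⟩
  rwa [← P.root.injective h]

theorem isNegRoot_root_iff [P.IsRootSystem] (i : ι) : IsNegRoot b (P.root i) ↔ ¬ b.IsPos i := by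
  let := P.indexNeg
  rw [← Base.IsPos.neg_iff_not, IsNegRoot, ← isPosRoot_root_iff]
  simp

/-- The coordinate of a vector at a simple root. -/
noncomputable def coord [P.IsRootSystem] (b : P.Base) (c : b.support) : V →ₗ[ℚ] ℚ :=
  b.toWeightBasis.coord c

section coord

variable [P.IsRootSystem]

theorem coord_root_self (c : b.support) : coord b c (P.root c) = 1 := by
  simp [coord]

theorem coord_root_of_ne {c d : b.support} (h : d ≠ c) : coord b c (P.root d) = 0 := by
  simp [coord, h]

theorem coord_root_nonneg (c d : b.support) : 0 ≤ coord b c (P.root d) := by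
  by_cases h : d = c
  · subst h; simp [coord_root_self]
  · simp [coord_root_of_ne h]

theorem sum_coord_smul (x : V) : ∑ c : b.support, coord b c x • P.root c = x := by
  simpa [coord] using b.toWeightBasis.sum_repr x

theorem coord_nonneg_of_isPos {i : ι} (h : b.IsPos i) (c : b.support) :
    0 ≤ coord b c (P.root i) := by
  rcases b.exists_root_eq_sum_nat_or_neg i with ⟨f, hf, h1 | h1⟩
  · rw [h1, map_sum]
    refine Finset.sum_nonneg fun j hj => ?_
    rw [map_nsmul]
    exact nsmul_nonneg (coord_root_nonneg c ⟨j, hj⟩) _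
  · have h2 : b.height i = ∑ j ∈ b.support, -(f j : ℤ) :=
      Base.height_eq_sum (by simpa using h1)
    have h3 : ∑ j ∈ b.support, -(f j : ℤ) ≤ 0 := Finset.sum_nonpos fun j _ => by simp
    rw [Base.isPos_iff] at h
    omega

theorem coord_nonpos_of_not_isPos {i : ι} (h : ¬ b.IsPos i) (c : b.support) :
    coord b c (P.root i) ≤ 0 := by
  let := P.indexNeg
  rw [← Base.IsPos.neg_iff_not] at h
  simpa using coord_nonneg_of_isPos h c

theorem isPos_of_coord_pos {i : ι} {c : b.support} (h : 0 < coord b c (P.root i)) :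
    b.IsPos i := by
  by_contra h'
  exact absurd (coord_nonpos_of_not_isPos h' c) (not_le.mpr h)

theorem exists_coord_pos {i : ι} (h : b.IsPos i) : ∃ c, 0 < coord b c (P.root i) := by
  by_contra! h'
  refine P.ne_zero i ?_
  rw [← sum_coord_smul (b := b) (P.root i)]
  refine Finset.sum_eq_zero fun c _ => ?_
  rw [le_antisymm (h' c) (coord_nonneg_of_isPos h c), zero_smul]

theorem coord_ofIdx_smul_of_ne {c d : b.support} (h : d ≠ c) (x : V) :
    coord b c (weylGroup.ofIdx P d • x) = coord b c x := by
  rw [ofIdx_smul_eq, map_sub, map_smul, coord_root_of_ne h]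
  simp

theorem coord_ofIdx_smul_self (c : b.support) (x : V) :
    coord b c (weylGroup.ofIdx P c • x) = coord b c x - P.toLinearMap x (P.coroot c) := by
  rw [ofIdx_smul_eq, map_sub, map_smul, coord_root_self]
  simp

theorem toLinearMap_coroot_eq_sum_coord (x : V) (i : ι) :
    P.toLinearMap x (P.coroot i) = ∑ d : b.support, coord b d x * P.pairing d i := by
  conv_lhs => rw [← sum_coord_smul (b := b) x]
  simp [root_coroot_eq_pairing]

/-- A weight that is nonnegative on the simple coroots is nonnegative on the positive ones; it
vanishes only on those whose root is supported where the weight vanishes. -/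
theorem dominant_nonneg [Finite ι] {ϖ : V}
    (hϖ : ∀ c : b.support, 0 ≤ P.toLinearMap ϖ (P.coroot c))
    {i : ι} (hi : b.IsPos i) :
    0 ≤ P.toLinearMap ϖ (P.coroot i) ∧ (P.toLinearMap ϖ (P.coroot i) = 0 →
      ∀ c : b.support, 0 < P.toLinearMap ϖ (P.coroot c) → coord b c (P.root i) = 0) := by
  let := Fintype.ofFinite ι
  have hs : ∀ c : b.support, 2 * P.RootForm ϖ (P.root c) = _ :=
    fun c => two_mul_rootForm (P := P) ϖ c
  have hp : ∀ c : b.support, 0 < P.RootForm (P.root c) (P.root c) :=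
    fun c => rootForm_root_pos (P := P) c
  have hexp : P.RootForm ϖ (P.root i) =
      ∑ c : b.support, coord b c (P.root i) * P.RootForm ϖ (P.root c) := by
    conv_lhs => rw [← sum_coord_smul (b := b) (P.root i)]
    simp only [map_sum, map_smul, smul_eq_mul]
  have hnn : ∀ c ∈ (Finset.univ : Finset b.support),
      0 ≤ coord b c (P.root i) * P.RootForm ϖ (P.root c) := fun c _ =>
    mul_nonneg (coord_nonneg_of_isPos hi c) (by
      have := mul_nonneg (hϖ c) (hp c).le
      linarith [hs c])
  have h2 := two_mul_rootForm (P := P) ϖ i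
  have hpi := rootForm_root_pos (P := P) i
  refine ⟨?_, fun h0 c hc => ?_⟩
  · have := Finset.sum_nonneg hnn
    rw [← hexp] at this
    exact nonneg_of_mul_nonneg_left (h2 ▸ (by linarith)) hpi
  · rw [h0, zero_mul] at h2
    have h3 : P.RootForm ϖ (P.root i) = 0 := by linarith
    rw [hexp, Finset.sum_eq_zero_iff_of_nonneg hnn] at h3
    rcases mul_eq_zero.mp (h3 c (Finset.mem_univ _)) with h4 | h4
    · exact h4
    · have := mul_pos hc (hp c)
      linarith [hs c]

end coord

theorem weylGroupToPerm_ofIdx (i j : ι) :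
    P.weylGroupToPerm (weylGroup.ofIdx P i) j = P.reflectionPerm i j := rfl

section pairing

variable [Finite ι] [P.IsCrystallographic]

theorem pairing_nonpos_of_ne {c d : b.support} (h : c ≠ d) : P.pairing c d ≤ 0 := by
  have := b.pairingIn_le_zero_of_ne (Subtype.coe_ne_coe.mpr h) c.2 d.2
  rw [← P.algebraMap_pairingIn ℤ]
  rw [eq_intCast]
  exact_mod_cast this

theorem pairing_le_neg_one_of_ne {c d : b.support} (h : c ≠ d) (h0 : P.pairing c d ≠ 0) :
    P.pairing c d ≤ -1 := by
  have := b.pairingIn_le_zero_of_ne (Subtype.coe_ne_coe.mpr h) c.2 d.2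
  rw [← P.algebraMap_pairingIn ℤ] at h0 ⊢
  have h1 : P.pairingIn ℤ c d ≠ 0 := fun h => h0 (by simp [h])
  have : P.pairingIn ℤ c d ≤ -1 := by omega
  rw [eq_intCast]
  exact_mod_cast this

end pairing


/-! ### Reduced words -/

/-- The product of the simple reflections along a list of simple roots. -/
noncomputable def reflProd (b : P.Base) (L : List b.support) : P.weylGroup :=
  (L.map fun c : b.support => weylGroup.ofIdx P (c : ι)).prod

@[simp] theorem reflProd_nil : reflProd b [] = 1 := rfl

@[simp] theorem reflProd_cons (c : b.support) (L : List b.support) :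
    reflProd b (c :: L) = weylGroup.ofIdx P c * reflProd b L := by
  simp [reflProd]

@[simp] theorem reflProd_append (L M : List b.support) :
    reflProd b (L ++ M) = reflProd b L * reflProd b M := by
  simp [reflProd]

theorem reflProd_reverse (L : List b.support) : reflProd b L.reverse = (reflProd b L)⁻¹ := by
  induction L with
  | nil => simp
  | cons c L ih => simp [ih, ofIdx_inv]

theorem weylGroupToPerm_mul_apply (u v : P.weylGroup) (i : ι) :
    P.weylGroupToPerm (u * v) i = P.weylGroupToPerm u (P.weylGroupToPerm v i) := by
  rw [map_mul]; rfl

/-- The list `L` is a shortest word in the simple reflections with its product. -/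
def IsReducedWord (b : P.Base) (L : List b.support) : Prop :=
  ∀ M : List b.support, reflProd b M = reflProd b L → L.length ≤ M.length

theorem IsReducedWord.left {A B : List b.support} (h : IsReducedWord b (A ++ B)) :
    IsReducedWord b A := by
  intro M hM
  have := h (M ++ B) (by simp [hM])
  simpa using this

theorem IsReducedWord.right {A B : List b.support} (h : IsReducedWord b (A ++ B)) :
    IsReducedWord b B := by
  intro M hM
  have := h (A ++ M) (by simp [hM])
  simpa using this

theorem IsReducedWord.reverse {A : List b.support} (h : IsReducedWord b A) :
    IsReducedWord b A.reverse := by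
  intro M hM
  have := h M.reverse (by rw [reflProd_reverse, hM, reflProd_reverse, inv_inv])
  simpa using this

section Finite

variable [Finite ι] [P.IsCrystallographic] [P.IsReduced]

/-- Reading the letters of a word one at a time, a positive root can only become negative at a
letter equal to the current root, as a simple reflection permutes the other positive roots. -/
theorem exists_append_cons_of_not_isPos (B : List b.support) {i : ι} (hi : b.IsPos i)
    (h : ¬ b.IsPos (P.weylGroupToPerm (reflProd b B)⁻¹ i)) :
    ∃ (A : List b.support) (d : b.support) (C : List b.support), B = A ++ d :: C ∧
      i = P.weylGroupToPerm (reflProd b A) d := by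
  induction B generalizing i with
  | nil => exact absurd hi (by simpa using h)
  | cons c B ih =>
    by_cases hic : i = c
    · exact ⟨[], c, B, rfl, by simpa using hic⟩
    · rw [reflProd_cons, mul_inv_rev, ofIdx_inv, weylGroupToPerm_mul_apply,
        weylGroupToPerm_ofIdx] at h
      obtain ⟨A, d, C, rfl, h2⟩ := ih (hi.reflectionPerm c.2 hic) h
      refine ⟨c :: A, d, C, rfl, ?_⟩
      rw [reflProd_cons, weylGroupToPerm_mul_apply, ← h2, weylGroupToPerm_ofIdx]
      simp

variable [P.IsRootSystem]

theorem IsReducedWord.isPos {c : b.support} {B : List b.support} (h : IsReducedWord b (c :: B)) :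
    b.IsPos (P.weylGroupToPerm (reflProd b B)⁻¹ c) := by
  by_contra hn
  obtain ⟨A, d, C, rfl, hc⟩ :=
    exists_append_cons_of_not_isPos B (Base.isPos_of_mem_support c.2) hn
  -- The letters `c` and `d` cancel, since `s_c` is the conjugate of `s_d` by the word `A`.
  have h1 := h (A ++ C) (by
    rw [reflProd_cons, hc, ofIdx_conj]
    simp [mul_assoc, ← mul_assoc (weylGroup.ofIdx P (d : ι)), ofIdx_mul_self])
  simp at h1

theorem IsReducedWord.isPos_left {c : b.support} {A : List b.support}
    (h : IsReducedWord b (A ++ [c])) : b.IsPos (P.weylGroupToPerm (reflProd b A) c) := by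
  have h1 : IsReducedWord b (c :: A.reverse) := by simpa using h.reverse
  simpa [reflProd_reverse] using h1.isPos

/-! ### Minuscule weights -/

omit [Finite ι] [P.IsCrystallographic] [P.IsReduced] [P.IsRootSystem] in
theorem toLinearMap_coroot_reflectionPerm (x : V) (i j : ι) :
    P.toLinearMap x (P.coroot (P.reflectionPerm i j)) =
      P.toLinearMap x (P.coroot j) - P.pairing i j * P.toLinearMap x (P.coroot i) := by
  rw [coroot_reflectionPerm, coreflection_apply, map_sub, map_smul, smul_eq_mul]
  rfl

/-- The weight `x` takes only the values `-1`, `0` and `1` on the coroots. -/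
def IsMinuscule (P : RootPairing ι ℚ V V') (x : V) : Prop :=
  ∀ i : ι, P.toLinearMap x (P.coroot i) = -1 ∨ P.toLinearMap x (P.coroot i) = 0 ∨
    P.toLinearMap x (P.coroot i) = 1

omit [P.IsCrystallographic] [P.IsReduced] [P.IsRootSystem] in
theorem IsMinuscule.smul {x : V} (hx : IsMinuscule P x) (w : P.weylGroup) :
    IsMinuscule P (w • x) := by
  intro i
  have := toLinearMap_inv_smul (P := P) w⁻¹ x i
  rw [inv_inv] at this
  rw [this]
  exact hx _

omit [Finite ι] [P.IsReduced] [P.IsRootSystem] in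
theorem exists_int_pairing (i j : ι) : ∃ n : ℤ, P.pairing i j = n :=
  ⟨P.pairingIn ℤ i j, by rw [← P.algebraMap_pairingIn ℤ, eq_intCast]⟩

omit [Finite ι] [P.IsReduced] [P.IsRootSystem] in
/-- Roots on which a minuscule weight is `-1` do not make obtuse angles: otherwise the weight would
be at most `-2` on the reflection of one of them in the other. -/
theorem IsMinuscule.pairing_nonneg {x : V} (hx : IsMinuscule P x) {i j : ι}
    (hi : P.toLinearMap x (P.coroot i) = -1) (hj : P.toLinearMap x (P.coroot j) = -1) :
    0 ≤ P.pairing i j := by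
  have h := toLinearMap_coroot_reflectionPerm (P := P) x i j
  obtain ⟨n, hn⟩ := exists_int_pairing (P := P) i j
  rw [hi, hj, hn] at h
  rw [hn]
  by_contra! hneg
  have h1 : n ≤ -1 := by
    have : n < 0 := by exact_mod_cast hneg
    omega
  have h2 : (n : ℚ) ≤ -1 := by exact_mod_cast h1
  rcases hx (P.reflectionPerm i j) with h3 | h3 | h3 <;> rw [h3] at h <;> linarith

/-- Read from right to left, each letter of the word `L` moves the weight down by exactly one
simple root, starting from `x`. -/
def Lowers (b : P.Base) (x : V) (L : List b.support) : Prop :=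
  ∀ (A : List b.support) (c : b.support) (B : List b.support),
      L = A ++ c :: B → P.toLinearMap (reflProd b B • x) (P.coroot c) = 1

omit [Finite ι] [P.IsCrystallographic] [P.IsReduced] [P.IsRootSystem] in
theorem Lowers.left {x : V} {L M : List b.support} (h : Lowers b x (L ++ M)) :
    Lowers b (reflProd b M • x) L := by
  rintro A c B rfl
  have := h A c (B ++ M) (by simp)
  rwa [reflProd_append, mul_smul] at this

omit [P.IsCrystallographic] [P.IsReduced] [P.IsRootSystem] in
theorem Lowers.apply_inversion {x : V} {A B : List b.support} {c : b.support}
    (h : Lowers b x (A ++ c :: B)) :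
    P.toLinearMap (reflProd b (A ++ c :: B) • x)
      (P.coroot (P.weylGroupToPerm (reflProd b A) c)) = -1 := by
  have h1 := h A c B rfl
  rw [reflProd_append, mul_smul, toLinearMap_smul_smul, reflProd_cons, mul_smul, ofIdx_smul_eq,
    h1, one_smul, map_sub, LinearMap.sub_apply, h1, root_coroot_two]
  norm_num

omit [P.IsReduced] [P.IsRootSystem] in
/-- The first letter of a word that lowers a minuscule weight does not make an obtuse angle with
any inversion of the word. -/
theorem Lowers.nonneg {x : V} (hx : IsMinuscule P x) {α c : b.support} {L A B : List b.support}
    (h : Lowers b x (α :: L)) (hL : α :: L = A ++ c :: B) :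
    0 ≤ P.toLinearMap ((reflProd b A)⁻¹ • P.root α) (P.coroot c) := by
  rw [toLinearMap_inv_smul, root_coroot_eq_pairing]
  refine (hx.smul (reflProd b (α :: L))).pairing_nonneg ?_ ?_
  · simpa using Lowers.apply_inversion (A := []) h
  · rw [hL] at h ⊢
    exact h.apply_inversion

section fundamental

variable {ϖ : V} {I : Set b.support}

open Classical in
omit [P.IsReduced] [P.IsCrystallographic] in
theorem isMinuscule_of_fundamental
    (h1 : ∀ i : b.support, P.toLinearMap ϖ (P.coroot i) = if i ∈ I then 0 else 1)
    (h2 : ∀ i, b.IsPos i → P.toLinearMap ϖ (P.coroot i) ≤ 1) : IsMinuscule P ϖ := by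
  have hdom : ∀ c : b.support, 0 ≤ P.toLinearMap ϖ (P.coroot c) := by
    intro c; rw [h1]; split_ifs <;> norm_num
  have hint : ∀ i, ∃ n : ℤ, P.toLinearMap ϖ (P.coroot i) = n := by
    intro i
    have hi := b.coroot_mem_span_int i
    generalize P.coroot i = y at hi
    induction hi using Submodule.span_induction with
    | mem y hy =>
      obtain ⟨j, hj, rfl⟩ := hy
      have := h1 ⟨j, hj⟩
      by_cases hI : (⟨j, hj⟩ : b.support) ∈ I
      · exact ⟨0, by simpa [hI] using this⟩
      · exact ⟨1, by simpa [hI] using this⟩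
    | zero => exact ⟨0, by simp⟩
    | add y z _ _ hy hz =>
      obtain ⟨m, hm⟩ := hy
      obtain ⟨n, hn⟩ := hz
      exact ⟨m + n, by simp [hm, hn]⟩
    | smul a y _ hy =>
      obtain ⟨m, hm⟩ := hy
      exact ⟨a * m, by simp [hm]⟩
  have hpos : ∀ i, b.IsPos i →
      P.toLinearMap ϖ (P.coroot i) = 0 ∨ P.toLinearMap ϖ (P.coroot i) = 1 := by
    intro i hi
    obtain ⟨n, hn⟩ := hint i
    have h3 := (dominant_nonneg hdom hi).1
    have h4 := h2 i hi
    rw [hn] at h3 h4 ⊢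
    have h5 : 0 ≤ n := by exact_mod_cast h3
    have h6 : n ≤ 1 := by exact_mod_cast h4
    have h7 : n = 0 ∨ n = 1 := by omega
    exact_mod_cast h7
  intro i
  rcases Base.IsPos.or_neg b i with hi | hi
  · rcases hpos i hi with h | h <;> simp [h]
  · have hneg := hpos _ hi
    rw [show P.toLinearMap ϖ (P.coroot _) = - P.toLinearMap ϖ (P.coroot i) by
      rw [← map_neg]; congr 1; simp] at hneg
    rcases hneg with h | h
    · right; left; linarith
    · left; linarith

open Classical in
/-- A reduced word of a minimal coset representative lowers the fundamental weight. -/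
theorem lowers_of_mem_minimalReps
    (h1 : ∀ i : b.support, P.toLinearMap ϖ (P.coroot i) = if i ∈ I then 0 else 1)
    (h2 : ∀ i, b.IsPos i → P.toLinearMap ϖ (P.coroot i) ≤ 1)
    {L : List b.support} (hL : IsReducedWord b L) (hI : reflProd b L ∈ minimalReps b I) :
    Lowers b ϖ L := by
  have hdom : ∀ c : b.support, 0 ≤ P.toLinearMap ϖ (P.coroot c) := by
    intro c; rw [h1]; split_ifs <;> norm_num
  rintro A c B rfl
  have hη := hL.right.isPos
  set η := P.weylGroupToPerm (reflProd b B)⁻¹ c with hηdef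
  have hval : P.toLinearMap (reflProd b B • ϖ) (P.coroot c) = P.toLinearMap ϖ (P.coroot η) := by
    have := toLinearMap_inv_smul (reflProd b B)⁻¹ ϖ c
    rwa [inv_inv] at this
  have hd := dominant_nonneg hdom hη
  rw [hval]
  rcases isMinuscule_of_fundamental h1 h2 η with h | h | h
  · linarith [hd.1]
  · exfalso
    -- The root `η` lies in the span of `I`, hence its image under `w` is positive.
    have hsupp := hd.2 h
    set w := reflProd b (A ++ c :: B) with hw
    have hwη : w • P.root η = - P.root (P.weylGroupToPerm (reflProd b A) c) := by
      rw [hηdef, ← weylGroup_apply_root, ← weylGroup_apply_root, hw, reflProd_append,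
        reflProd_cons, mul_smul, mul_smul, smul_inv_smul, ofIdx_smul_eq, root_coroot_two]
      rw [two_smul, sub_add_cancel_left, smul_neg]
    have hpos : b.IsPos (P.weylGroupToPerm (reflProd b A) c) := by
      have : IsReducedWord b (A ++ [c]) := by
        have h3 : A ++ c :: B = (A ++ [c]) ++ B := by simp
        rw [h3] at hL
        exact hL.left
      exact this.isPos_left
    obtain ⟨d, hd'⟩ := exists_coord_pos hpos
    have hneg : coord b d (w • P.root η) < 0 := by rw [hwη, map_neg]; linarith
    refine absurd hneg (not_lt.mpr ?_)
    have hlin : ∀ y z : V, w • (y + z) = w • y + w • z := fun y z => smul_add w y z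
    let f : V →+ V := ⟨⟨fun y => w • y, smul_zero w⟩, hlin⟩
    have hexp : w • P.root η = ∑ e : b.support, coord b e (P.root η) • w • P.root e := by
      conv_lhs => rw [← sum_coord_smul (b := b) (P.root η)]
      change f _ = _
      rw [map_sum]
      exact Finset.sum_congr rfl fun e _ => smul_rat_smul w _ _
    rw [hexp, map_sum]
    refine Finset.sum_nonneg fun e _ => ?_
    rw [map_smul, smul_eq_mul]
    by_cases he : e ∈ I
    · obtain ⟨i, hi, hi'⟩ := hI e he
      rw [← hi']
      exact mul_nonneg (coord_nonneg_of_isPos hη e) (coord_nonneg_of_isPos hi d)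
    · rw [hsupp e (by rw [h1, if_neg he]; norm_num), zero_mul]
  · exact h

end fundamental

end Finite


/-! ### The root attached to a prefix of the word -/

section Finite

variable [Finite ι] [P.IsCrystallographic] [P.IsRootSystem]

/-- A nonnegative combination of simple roots is strictly negative on the coroots of the simple
roots outside its support that are linked to the support. -/
theorem toLinearMap_coroot_neg {x : V} (hx : ∀ d : b.support, 0 ≤ coord b d x) {c d : b.support}
    (hc : coord b c x = 0) (hd : 0 < coord b d x) (hdc : P.pairing d c ≠ 0) :
    P.toLinearMap x (P.coroot c) < 0 := by
  rw [toLinearMap_coroot_eq_sum_coord (b := b)]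
  refine Finset.sum_neg' (fun e _ => ?_) ⟨d, Finset.mem_univ _, ?_⟩
  · by_cases he : e = c
    · rw [he, hc, zero_mul]
    · exact mul_nonpos_of_nonneg_of_nonpos (hx e) (pairing_nonpos_of_ne he)
  · have hne : d ≠ c := by rintro rfl; exact hd.ne' hc
    exact mul_neg_of_pos_of_neg hd (lt_of_le_of_ne (pairing_nonpos_of_ne hne) hdc)

omit [Finite ι] [P.IsCrystallographic] [P.IsRootSystem] in
/-- Every letter of the word except the first is linked to, or equal to, an earlier one. -/
def Grows (b : P.Base) (L : List b.support) : Prop :=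
  ∀ (A : List b.support) (c : b.support) (B : List b.support),
      L = A ++ c :: B → A ≠ [] → ∃ d ∈ A, P.pairing d c ≠ 0

omit [Finite ι] [P.IsCrystallographic] [P.IsRootSystem] in
theorem Grows.left {A B : List b.support} (h : Grows b (A ++ B)) : Grows b A := by
  rintro C c D rfl
  exact h C c (D ++ B) (by simp)

/-- The negative of `w⁻¹ α`, for a growing word of `w` starting with `α` whose inversions do not make
obtuse angles with `α`, is a nonnegative combination of simple roots whose support is the set of all
letters of the word. -/
theorem coord_neg_inv_smul {α : b.support} (L : List b.support)
    (hnn : ∀ (A : List b.support) (c : b.support) (B : List b.support),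
      α :: L = A ++ c :: B →
      0 ≤ P.toLinearMap ((reflProd b A)⁻¹ • P.root α) (P.coroot c))
    (hg : Grows b (α :: L)) (d : b.support) :
    0 ≤ coord b d (-((reflProd b (α :: L))⁻¹ • P.root α)) ∧
      (0 < coord b d (-((reflProd b (α :: L))⁻¹ • P.root α)) ↔ d ∈ α :: L) := by
  induction L using List.reverseRecOn generalizing d with
  | nil =>
    have : -((reflProd b [α])⁻¹ • P.root α) = P.root α := by
      rw [reflProd_cons, reflProd_nil, mul_one, ofIdx_inv, ofIdx_smul_eq, root_coroot_two, two_smul]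
      simp
    rw [this]
    refine ⟨coord_root_nonneg _ _, ?_⟩
    by_cases h : d = α
    · subst h; simp [coord_root_self]
    · simp [h, coord_root_of_ne (Ne.symm h)]
  | append_singleton M c ih =>
    rw [← List.cons_append] at hnn hg ⊢
    have ih' := ih (fun A e B h => hnn A e (B ++ [c]) (by rw [h]; simp)) hg.left
    have hc := hnn (α :: M) c [] rfl
    set ψ := (reflProd b (α :: M))⁻¹ • P.root α with hψ
    have hnew : (reflProd b (α :: M ++ [c]))⁻¹ • P.root α = weylGroup.ofIdx P (c : ι) • ψ := by
      rw [reflProd_append, mul_inv_rev, mul_smul, reflProd_cons, reflProd_nil, mul_one, ofIdx_inv]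
    rw [hnew]
    by_cases hdc : d = c
    · subst hdc
      rw [map_neg, coord_ofIdx_smul_self]
      have h1 := (ih' d).1
      rw [map_neg] at h1
      refine ⟨by linarith, by simp, fun _ => ?_⟩
      by_cases hmem : d ∈ α :: M
      · have h2 := (ih' d).2.mpr hmem
        rw [map_neg] at h2
        linarith
      · obtain ⟨e, he, hed⟩ := hg (α :: M) d [] rfl (by simp)
        have h3 : coord b d (-ψ) = 0 :=
          le_antisymm (not_lt.mp fun h => hmem ((ih' d).2.mp h)) (ih' d).1
        have h4 := toLinearMap_coroot_neg (fun d => (ih' d).1) h3 ((ih' e).2.mpr he) hed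
        rw [map_neg, LinearMap.neg_apply] at h4
        linarith
    · rw [map_neg, coord_ofIdx_smul_of_ne (Ne.symm hdc), ← map_neg]
      have := ih' d
      simpa [hdc] using this

omit [Finite ι] [P.IsCrystallographic] in
theorem coord_inv_smul_of_notMem {γ : b.support} {L : List b.support} (h : γ ∉ L) (x : V) :
    coord b γ ((reflProd b L)⁻¹ • x) = coord b γ x := by
  induction L generalizing x with
  | nil => simp
  | cons c L ih =>
    simp only [List.mem_cons, not_or] at h
    rw [reflProd_cons, mul_inv_rev, ofIdx_inv, mul_smul, ih h.2,
      coord_ofIdx_smul_of_ne (Ne.symm h.1)]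

omit [P.IsRootSystem] in
/-- Lowering a weight along letters other than `γ` raises its value on `γ`, strictly so if one of
the letters is linked to `γ`. -/
theorem Lowers.le_apply {γ : b.support} {y : V} (S : List b.support) (h : Lowers b y S)
    (hγ : γ ∉ S) :
    P.toLinearMap y (P.coroot γ) ≤ P.toLinearMap (reflProd b S • y) (P.coroot γ) ∧
      ((∃ d ∈ S, P.pairing d γ ≠ 0) →
        P.toLinearMap y (P.coroot γ) + 1 ≤ P.toLinearMap (reflProd b S • y) (P.coroot γ)) := by
  induction S with
  | nil => simp
  | cons c S ih =>
    simp only [List.mem_cons, not_or] at hγ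
    have hS : Lowers b y S := by
      rintro A d B rfl
      exact h (c :: A) d B (by simp)
    obtain ⟨ih1, ih2⟩ := ih hS hγ.2
    have hval : P.toLinearMap (reflProd b (c :: S) • y) (P.coroot γ) =
        P.toLinearMap (reflProd b S • y) (P.coroot γ) - P.pairing c γ := by
      rw [reflProd_cons, mul_smul, ofIdx_smul_eq, h [] c S rfl, one_smul, map_sub,
        LinearMap.sub_apply, root_coroot_eq_pairing]
    have hle := pairing_nonpos_of_ne (b := b) (Ne.symm hγ.1)
    rw [hval]
    refine ⟨by linarith, ?_⟩
    rintro ⟨d, hd, hdγ⟩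
    rcases List.mem_cons.mp hd with rfl | hd
    · have := pairing_le_neg_one_of_ne (b := b) (Ne.symm hγ.1) hdγ
      linarith
    · have := ih2 ⟨d, hd, hdγ⟩
      linarith

/-- A growing word that lowers a minuscule weight has no left descent besides its first letter. -/
theorem eq_head_of_not_isPos [P.IsReduced] {x : V} {α γ : b.support}
    {L : List b.support} (h : Lowers b x (α :: L)) (hg : Grows b (α :: L))
    (hγ : ¬ b.IsPos (P.weylGroupToPerm (reflProd b (α :: L))⁻¹ γ)) : γ = α := by
  have hval : P.toLinearMap (reflProd b (α :: L) • x) (P.coroot γ) = -1 := by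
    obtain ⟨A, d, C, hA, hd⟩ := exists_append_cons_of_not_isPos (α :: L)
      (Base.isPos_of_mem_support γ.2) hγ
    rw [hA] at h ⊢
    rw [hd]
    exact h.apply_inversion
  have hmem : γ ∈ α :: L := by
    by_contra hn
    refine hγ (isPos_of_coord_pos (c := γ) ?_)
    rw [← weylGroup_apply_root, coord_inv_smul_of_notMem hn, coord_root_self]
    exact one_pos
  -- At the first occurrence of `γ` the value on `γ` drops to `-1`; the letters before it raise it.
  obtain ⟨A, B, hAB, hnA⟩ := List.eq_append_cons_of_mem hmem
  by_contra hne
  have hA : A ≠ [] := by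
    rintro rfl
    simp only [List.nil_append, List.cons.injEq] at hAB
    exact hne hAB.1.symm
  have hadj := hg A γ B hAB hA
  rw [hAB] at h hval
  have h1 := (h.left.le_apply A hnA).2 hadj
  have h2 : P.toLinearMap (reflProd b (γ :: B) • x) (P.coroot γ) = -1 := by
    have h3 := h A γ B rfl
    rw [reflProd_cons, mul_smul, ofIdx_smul_eq, h3, one_smul, map_sub, LinearMap.sub_apply, h3,
      root_coroot_two]
    norm_num
  rw [h2, ← mul_smul, ← reflProd_append, hval] at h1
  linarith

omit [Finite ι] in
/-- If all steps along a word lower a root, the result is dominated by the root; in case of equality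
the root is orthogonal to all letters. -/
theorem dominates_inv_smul (L : List b.support) (i : ι)
    (h : ∀ (A : List b.support) (c : b.support) (B : List b.support),
      L = A ++ c :: B →
      0 ≤ P.toLinearMap ((reflProd b A)⁻¹ • P.root i) (P.coroot c)) :
    Dominates b (P.root i) ((reflProd b L)⁻¹ • P.root i) ∧
      (∀ d : b.support, coord b d ((reflProd b L)⁻¹ • P.root i) ≤ coord b d (P.root i)) ∧
      ((reflProd b L)⁻¹ • P.root i = P.root i → ∀ c ∈ L, P.pairing i c = 0) := by
  induction L generalizing i with
  | nil => simp [Dominates]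
  | cons c L ih =>
    have hc : 0 ≤ P.pairing i c := by
      simpa [root_coroot_eq_pairing] using h [] c L rfl
    have hstep : P.root (P.reflectionPerm c i) = P.root i - P.pairing i c • P.root c := by
      rw [root_reflectionPerm, reflection_apply_root]
    have hsmul : (reflProd b (c :: L))⁻¹ • P.root i =
        (reflProd b L)⁻¹ • P.root (P.reflectionPerm c i) := by
      rw [reflProd_cons, mul_inv_rev, ofIdx_inv, mul_smul, weylGroup_apply_root,
        weylGroupToPerm_ofIdx]
    obtain ⟨ih1, ih2, ih3⟩ := ih (P.reflectionPerm c i) (by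
      rintro A d B rfl
      have := h (c :: A) d B rfl
      rwa [reflProd_cons, mul_inv_rev, ofIdx_inv, mul_smul, weylGroup_apply_root (P := P) _ i,
        weylGroupToPerm_ofIdx] at this)
    rw [hsmul]
    refine ⟨?_, fun d => ?_, fun heq => ?_⟩
    · have h1 : P.root i - P.root (P.reflectionPerm c i) ∈
          AddSubmonoid.closure (P.root '' b.support) := by
        obtain ⟨n, hn⟩ := exists_int_pairing (P := P) i c
        rw [hn] at hc
        have hn0 : 0 ≤ n := by exact_mod_cast hc
        lift n to ℕ using hn0
        rw [hstep, sub_sub_cancel, hn, Int.cast_natCast, Nat.cast_smul_eq_nsmul]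
        exact AddSubmonoid.nsmul_mem _
          (AddSubmonoid.subset_closure (Set.mem_image_of_mem _ c.2)) n
      have h2 := add_mem h1 ih1
      rwa [sub_add_sub_cancel] at h2
    · refine (ih2 d).trans ?_
      rw [hstep, map_sub, map_smul, smul_eq_mul]
      have := mul_nonneg hc (coord_root_nonneg d c)
      linarith
    · have h0 : P.pairing i c = 0 := by
        have := ih2 c
        rw [heq, hstep, map_sub, map_smul, smul_eq_mul, coord_root_self] at this
        linarith
      rw [h0, zero_smul, sub_zero] at hstep
      have hi : P.reflectionPerm c i = i := P.root.injective hstep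
      rw [hi] at ih3 heq
      intro d hd
      rcases List.mem_cons.mp hd with rfl | hd
      · exact h0
      · exact ih3 heq d hd

/-! ### A minuscule parabolic subgroup is maximal -/

omit [P.IsRootSystem] [Finite ι] [P.IsCrystallographic] in
/-- Adjoining to a sum of simple coroots that is a coroot a further simple coroot which is linked to
the sum by a single bond. -/
theorem exists_coroot_eq_sum_cons {n : ℕ} (s : Fin n → ι) (C : Matrix (Fin n) (Fin n) ℤ)
    (hC : ∀ i j, P.pairing (s i) (s j) = C i j) (T : List (Fin n)) (a : Fin n)
    (hT : ∃ r, P.coroot r = (T.map fun j => P.coroot (s j)).sum)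
    (ha : (T.map (C a)).sum = -1) :
    ∃ r, P.coroot r = ((a :: T).map fun j => P.coroot (s j)).sum := by
  obtain ⟨r, hr⟩ := hT
  refine ⟨P.reflectionPerm (s a) r, ?_⟩
  have hsum : P.toLinearMap (P.root (s a)) (T.map fun j => P.coroot (s j)).sum =
      ((T.map (C a)).sum : ℤ) := by
    clear hr ha
    induction T with
    | nil => simp
    | cons j T ih => simp [ih, root_coroot_eq_pairing, hC]
  rw [coroot_reflectionPerm, coreflection_apply]
  change _ - P.toLinearMap (P.root (s a)) (P.coroot r) • _ = _
  rw [hr, hsum, ha]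
  simp [add_comm]

omit [P.IsRootSystem] [Finite ι] in
/-- In type `E₆` or `E₇` the sum of all simple coroots is a coroot: in Bourbaki's labelling, add the
nodes in the order `1, 3, 4, 2, 5, 6` and, for `E₇`, `7`, each linked to exactly one earlier node. -/
theorem exists_coroot_eq_sum (hE : IsTypeE6 b ∨ IsTypeE7 b) :
    ∃ r, P.coroot r = ∑ c : b.support, P.coroot c := by
  rcases hE with ⟨e, he⟩ | ⟨e, he⟩
  · have hC : ∀ i j, P.pairing (e.symm i) (e.symm j) = CartanMatrix.E₆ i j := by
      intro i j
      have := he (e.symm i) (e.symm j)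
      rw [Equiv.apply_symm_apply, Equiv.apply_symm_apply] at this
      rw [← this, ← P.algebraMap_pairingIn ℤ, eq_intCast]
      rfl
    have h : ∃ r, P.coroot r =
        (([5, 4, 1, 3, 2, 0] : List (Fin 6)).map fun j => P.coroot (e.symm j : ι)).sum := by
      iterate 5 refine exists_coroot_eq_sum_cons (fun j => (e.symm j : ι)) _ hC _ _ ?_ (by decide)
      exact ⟨e.symm 0, by simp⟩
    obtain ⟨r, hr⟩ := h
    refine ⟨r, ?_⟩
    rw [hr, ← e.symm.sum_comp]
    simp [Fin.sum_univ_succ]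
    abel
  · have hC : ∀ i j, P.pairing (e.symm i) (e.symm j) = CartanMatrix.E₇ i j := by
      intro i j
      have := he (e.symm i) (e.symm j)
      rw [Equiv.apply_symm_apply, Equiv.apply_symm_apply] at this
      rw [← this, ← P.algebraMap_pairingIn ℤ, eq_intCast]
      rfl
    have h : ∃ r, P.coroot r =
        (([6, 5, 4, 1, 3, 2, 0] : List (Fin 7)).map fun j => P.coroot (e.symm j : ι)).sum := by
      iterate 6 refine exists_coroot_eq_sum_cons (fun j => (e.symm j : ι)) _ hC _ _ ?_ (by decide)
      exact ⟨e.symm 0, by simp⟩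
    obtain ⟨r, hr⟩ := h
    refine ⟨r, ?_⟩
    rw [hr, ← e.symm.sum_comp]
    simp [Fin.sum_univ_succ]
    abel

open Classical in
/-- At most one simple root lies outside `I`, since `ϖ` is at most `1` on the sum of all simple
coroots. -/
theorem eq_of_notMem [P.IsReduced] (hE : IsTypeE6 b ∨ IsTypeE7 b) {I : Set b.support} {ϖ : V}
    (h1 : ∀ i : b.support, P.toLinearMap ϖ (P.coroot i) = if i ∈ I then 0 else 1)
    (h2 : ∀ i, b.IsPos i → P.toLinearMap ϖ (P.coroot i) ≤ 1)
    {c d : b.support} (hc : c ∉ I) (hd : d ∉ I) : c = d := by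
  by_contra hne
  obtain ⟨r, hr⟩ := exists_coroot_eq_sum hE
  have hsum : 2 ≤ P.toLinearMap ϖ (P.coroot r) := by
    rw [hr, map_sum]
    have h3 : ∑ i ∈ ({c, d} : Finset b.support), P.toLinearMap ϖ (P.coroot i) ≤
        ∑ i : b.support, P.toLinearMap ϖ (P.coroot i) := by
      refine Finset.sum_le_sum_of_subset_of_nonneg (Finset.subset_univ _) fun i _ _ => ?_
      rw [h1]; split_ifs <;> norm_num
    rw [Finset.sum_pair hne, h1, h1, if_neg hc, if_neg hd] at h3
    linarith
  rcases isMinuscule_of_fundamental h1 h2 r with h | h | h <;> linarith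

end Finite


/-! ### The quiver of a word -/

theorem ofIdx_mul_comm [P.IsRootSystem] {i j : ι} (h : P.pairing i j = 0)
    (h' : P.pairing j i = 0) :
    weylGroup.ofIdx P i * weylGroup.ofIdx P j = weylGroup.ofIdx P j * weylGroup.ofIdx P i := by
  apply weylGroup_ext
  intro x
  rw [mul_smul, mul_smul]
  simp only [ofIdx_smul_eq, map_sub, map_smul, LinearMap.sub_apply, LinearMap.smul_apply,
    root_coroot_eq_pairing, h, h', smul_eq_mul, mul_zero, sub_zero]
  abel

theorem reflProd_mul_ofIdx [P.IsRootSystem] {c : b.support} {M : List b.support}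
    (h : ∀ d ∈ M, P.pairing c d = 0 ∧ P.pairing d c = 0) :
    weylGroup.ofIdx P c * reflProd b M = reflProd b M * weylGroup.ofIdx P c := by
  induction M with
  | nil => simp
  | cons d M ih =>
    have hd := h d List.mem_cons_self
    rw [reflProd_cons, ← mul_assoc, ofIdx_mul_comm hd.1 hd.2, mul_assoc,
      ih fun e he => h e (List.mem_cons_of_mem d he), mul_assoc]

theorem inv_smul_of_orthogonal {c : b.support} {M : List b.support}
    (h : ∀ d ∈ M, P.pairing c d = 0) : (reflProd b M)⁻¹ • P.root c = P.root c := by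
  induction M with
  | nil => simp
  | cons d M ih =>
    rw [reflProd_cons, mul_inv_rev, mul_smul, ofIdx_inv, ofIdx_smul_eq, root_coroot_eq_pairing,
      h d List.mem_cons_self, zero_smul, sub_zero, ih fun e he => h e (List.mem_cons_of_mem d he)]

section Finite

variable [Finite ι] [P.IsRootSystem] [P.IsCrystallographic] [P.IsReduced]

/-- Between two occurrences of a letter in a reduced word there is a letter that does not commute
with it. -/
theorem IsReducedWord.exists_pairing_ne_zero {c : b.support} {B D : List b.support}
    (h : IsReducedWord b (c :: (B ++ c :: D))) : ∃ d ∈ B, P.pairing c d ≠ 0 := by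
  by_contra! hB
  have h1 := h.isPos
  have h2 : b.IsPos (P.weylGroupToPerm (reflProd b D)⁻¹ c) :=
    IsReducedWord.isPos (IsReducedWord.right (A := c :: B) h)
  obtain ⟨d, hd⟩ := exists_coord_pos h2
  have h3 := coord_nonneg_of_isPos h1 d
  rw [← weylGroup_apply_root, reflProd_append, mul_inv_rev, mul_smul, inv_smul_of_orthogonal hB,
    reflProd_cons, mul_inv_rev, mul_smul, ofIdx_inv, ofIdx_smul_eq, root_coroot_two, two_smul,
    sub_add_cancel_left, smul_neg, map_neg, weylGroup_apply_root] at h3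
  linarith

variable {k : ℕ} {β : Fin k → b.support}

open Classical in
/-- The vertices in `Q`, in increasing order. -/
noncomputable def positions {k : ℕ} (Q : Set (Fin k)) : List (Fin k) :=
  (List.finRange k).filter (fun i => i ∈ Q)

omit [Finite ι] [P.IsRootSystem] [P.IsCrystallographic] [P.IsReduced] in
theorem subwordProd_eq (β : Fin k → b.support) (Q : Set (Fin k)) :
    subwordProd b β Q = reflProd b ((positions Q).map β) := by
  simp only [subwordProd, reflProd, positions, List.map_map]
  rfl

omit [Finite ι] [P.IsRootSystem] [P.IsCrystallographic] [P.IsReduced] in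
theorem wordProd_eq (β : Fin k → b.support) :
    wordProd b β = reflProd b ((List.finRange k).map β) := by
  simp only [wordProd, reflProd, List.map_map]
  rfl

omit [Finite ι] [P.IsRootSystem] [P.IsCrystallographic] [P.IsReduced] in
theorem IsReducedDecomposition.isReducedWord {w : P.weylGroup}
    (h : IsReducedDecomposition b w β) : IsReducedWord b ((List.finRange k).map β) := by
  intro M hM
  rw [← wordProd_eq, h.1] at hM
  have := h.2 M.length M.get (by rw [wordProd_eq, ← hM]; simp)
  simpa using this

theorem mem_positions {Q : Set (Fin k)} {x : Fin k} : x ∈ positions Q ↔ x ∈ Q := by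
  simp [positions]

theorem positions_univ : positions (Set.univ : Set (Fin k)) = List.finRange k := by
  simp [positions]

theorem mem_and_lt_of_positions_eq {Q : Set (Fin k)} {A B : List (Fin k)} {x : Fin k}
    (h : positions Q = A ++ x :: B) :
    (∀ a, a ∈ A ↔ a ∈ Q ∧ a < x) ∧ ∀ a, a ∈ B ↔ a ∈ Q ∧ x < a := by
  have hp : (A ++ x :: B).Pairwise (· < ·) := by
    rw [← h]
    exact (List.pairwise_lt_finRange k).filter _
  have hmem : ∀ a, a ∈ Q ↔ a ∈ A ∨ a = x ∨ a ∈ B := by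
    intro a
    rw [← mem_positions, h]
    simp
  rw [List.pairwise_append, List.pairwise_cons] at hp
  obtain ⟨-, ⟨h2, -⟩, h3⟩ := hp
  have h3x : ∀ a ∈ A, a < x := fun a ha => h3 a ha x List.mem_cons_self
  refine ⟨fun a => ⟨fun ha => ⟨(hmem a).mpr (Or.inl ha), h3x a ha⟩, fun ⟨ha, hlt⟩ => ?_⟩,
    fun a => ⟨fun ha => ⟨(hmem a).mpr (Or.inr (Or.inr ha)), h2 a ha⟩, fun ⟨ha, hlt⟩ => ?_⟩⟩
  · rcases (hmem a).mp ha with h | h | h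
    · exact h
    · exact absurd hlt (h ▸ lt_irrefl _)
    · exact absurd (h2 a h) (not_lt.mpr hlt.le)
  · rcases (hmem a).mp ha with h | h | h
    · exact absurd (h3x a h) (not_lt.mpr hlt.le)
    · exact absurd hlt (h ▸ lt_irrefl _)
    · exact h

omit [Finite ι] [P.IsRootSystem] [P.IsCrystallographic] [P.IsReduced] in
theorem QuiverLE.le {Q : Set (Fin k)} {i j : Fin k} (h : QuiverLE b β Q i j) : i ≤ j := by
  induction h with
  | refl => exact le_rfl
  | tail _ h ih => exact ih.trans h.2.2.2.1.le

/-- Vertices of the quiver of a reduced word whose reflections do not commute are comparable. -/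
theorem quiverLE_of_lt (hβ : IsReducedWord b ((List.finRange k).map β)) {x y : Fin k}
    (hxy : x < y) (h : P.pairing (β x) (β y) ≠ 0) : QuiverLE b β Set.univ x y := by
  induction hn : (y : ℕ) - x using Nat.strong_induction_on generalizing x y with
  | _ n ih =>
  subst hn
  have hself : ∀ c : b.support, P.pairing c c ≠ 0 := fun c => by simp
  by_cases h1 : ∀ l, x < l → l ≤ y → β l ≠ β x
  · exact Relation.ReflTransGen.single ⟨trivial, trivial, h, hxy, h1⟩
  push Not at h1
  obtain ⟨l, hxl, hly, hl⟩ := h1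
  rcases hly.lt_or_eq with hly | rfl
  · refine (ih _ (by omega) hxl (hl ▸ hself _) rfl).trans (ih _ (by omega) hly ?_ rfl)
    rwa [hl]
  · -- Some letter between two occurrences of the same letter does not commute with it.
    obtain ⟨m, hxm, hml, hm⟩ : ∃ m, x < m ∧ m < l ∧ P.pairing (β x) (β m) ≠ 0 := by
      obtain ⟨A, B, hAB⟩ := List.append_of_mem (List.mem_finRange x)
      rw [← positions_univ] at hAB
      have hB := (mem_and_lt_of_positions_eq hAB).2
      obtain ⟨C, D, rfl⟩ := List.append_of_mem ((hB l).mpr ⟨trivial, hxl⟩)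
      have hC := (mem_and_lt_of_positions_eq (A := A ++ x :: C) (x := l) (B := D)
        (by rw [hAB]; simp)).1
      rw [← positions_univ, hAB, List.map_append, List.map_cons, List.map_append, List.map_cons,
        hl] at hβ
      obtain ⟨d, hd, hd'⟩ := hβ.right.exists_pairing_ne_zero
      obtain ⟨m, hm, rfl⟩ := List.mem_map.mp hd
      exact ⟨m, ((hB m).mp (by simp [hm])).2, ((hC m).mp (by simp [hm])).2, hd'⟩
    refine (ih _ (by omega) hxm hm rfl).trans (ih _ (by omega) hml ?_ rfl)
    rw [hl]
    exact fun h0 => hm (P.pairing_eq_zero_iff.mp h0)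

/-- The factorization of a reduced word along an order ideal of its quiver. -/
theorem reflProd_positions_mul (hβ : IsReducedWord b ((List.finRange k).map β)) {Q : Set (Fin k)}
    (hQ : ∀ x y, QuiverLE b β Set.univ x y → y ∈ Q → x ∈ Q) :
    reflProd b ((positions Q).map β) * reflProd b ((positions Qᶜ).map β) =
      reflProd b ((List.finRange k).map β) := by
  classical
  have hp := List.pairwise_lt_finRange k
  simp only [positions]
  generalize List.finRange k = ℓ at hp
  induction ℓ with
  | nil => simp
  | cons x ℓ ih =>
    rw [List.pairwise_cons] at hp
    by_cases hx : x ∈ Q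
    · rw [List.filter_cons_of_pos (by simpa using hx), List.filter_cons_of_neg (by simpa using hx)]
      simp only [List.map_cons, reflProd_cons, mul_assoc]
      rw [← ih hp.2]
    · rw [List.filter_cons_of_neg (by simpa using hx), List.filter_cons_of_pos (by simpa using hx)]
      simp only [List.map_cons, reflProd_cons]
      rw [← ih hp.2, ← mul_assoc, ← reflProd_mul_ofIdx, mul_assoc]
      intro d hd
      obtain ⟨y, hy, rfl⟩ := List.mem_map.mp hd
      rw [List.mem_filter, decide_eq_true_iff] at hy
      have h0 : P.pairing (β x) (β y) = 0 := by
        by_contra h0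
        exact hx (hQ x y (quiverLE_of_lt hβ (hp.1 y hy.1) h0) hy.2)
      exact ⟨h0, P.pairing_eq_zero_iff.mp h0⟩

theorem length_positions_add (Q : Set (Fin k)) :
    (positions Q).length + (positions Qᶜ).length = k := by
  classical
  have := List.length_eq_length_filter_add (l := List.finRange k) (fun i => decide (i ∈ Q))
  rw [List.length_finRange] at this
  simpa [positions] using this.symm

omit [Finite ι] [P.IsRootSystem] [P.IsCrystallographic] [P.IsReduced] in
theorem exists_peak_le (β : Fin k → b.support) (y : Fin k) :
    ∃ p ∈ peaks b β Set.univ, QuiverLE b β Set.univ p y := by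
  classical
  obtain ⟨p, hp, hmin⟩ := Finset.exists_min_image
    (Finset.univ.filter fun p => QuiverLE b β Set.univ p y) id
    ⟨y, Finset.mem_filter.mpr ⟨Finset.mem_univ _, Relation.ReflTransGen.refl⟩⟩
  simp only [Finset.mem_filter, Finset.mem_univ, true_and, id] at hp hmin
  exact ⟨p, ⟨trivial, fun j _ hj => le_antisymm hj.le (hmin j (hj.trans hp))⟩, hp⟩

omit [Finite ι] [P.IsRootSystem] [P.IsCrystallographic] [P.IsReduced] in
theorem exists_maximal_ge (β : Fin k → b.support) (y : Fin k) :
    ∃ m, QuiverLE b β Set.univ y m ∧ ∀ z, QuiverLE b β Set.univ m z → z = m := by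
  classical
  obtain ⟨m, hm, hmax⟩ := Finset.exists_max_image
    (Finset.univ.filter fun p => QuiverLE b β Set.univ y p) id
    ⟨y, Finset.mem_filter.mpr ⟨Finset.mem_univ _, Relation.ReflTransGen.refl⟩⟩
  simp only [Finset.mem_filter, Finset.mem_univ, true_and, id] at hm hmax
  exact ⟨m, hm, fun z hz => le_antisymm (hmax z (hm.trans hz)) hz.le⟩

open Classical in
/-- The label of a maximal vertex is a right descent, hence lies outside `I`. -/
theorem notMem_of_maximal {ϖ : V} {I : Set b.support}
    (h1 : ∀ i : b.support, P.toLinearMap ϖ (P.coroot i) = if i ∈ I then 0 else 1)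
    (hβ : IsReducedWord b ((List.finRange k).map β))
    (hlow : Lowers b ϖ ((List.finRange k).map β)) {m : Fin k}
    (hm : ∀ z, QuiverLE b β Set.univ m z → z = m) : β m ∉ I := by
  intro hI
  obtain ⟨A, B, hAB⟩ := List.append_of_mem (List.mem_finRange m)
  have h := hlow (A.map β) (β m) (B.map β) (by rw [hAB]; simp)
  rw [← positions_univ] at hAB
  have horth : (reflProd b (B.map β))⁻¹ • P.root (β m) = P.root (β m) := by
    refine inv_smul_of_orthogonal fun d hd => ?_
    obtain ⟨y, hy, rfl⟩ := List.mem_map.mp hd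
    have hlt := (((mem_and_lt_of_positions_eq hAB).2 y).mp hy).2
    by_contra h0
    exact hlt.ne' (hm y (quiverLE_of_lt hβ hlt h0))
  rw [weylGroup_apply_root] at horth
  have h2 := toLinearMap_inv_smul (P := P) (reflProd b (B.map β))⁻¹ ϖ (β m)
  rw [inv_inv, P.root.injective horth, h, h1, if_pos hI] at h2
  norm_num at h2

omit [Finite ι] [P.IsRootSystem] [P.IsCrystallographic] [P.IsReduced] in
theorem length_constructionOneAux (β : Fin k → b.support) (Q : Set (Fin k))
    (l : List (Fin k)) : (constructionOneAux b β Q l).length = l.length := by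
  induction l generalizing Q with
  | nil => rfl
  | cons i l ih => simp [constructionOneAux, ih]

/-! ### The vertices above a single peak -/

omit [Finite ι] [P.IsRootSystem] [P.IsCrystallographic] [P.IsReduced] in
theorem mem_subquiver_of_le {p x y : Fin k} (h : QuiverLE b β Set.univ x y)
    (hy : y ∈ subquiver b β Set.univ {p}) : x ∈ subquiver b β Set.univ {p} :=
  ⟨trivial, fun j hj hjx => hy.2 j hj (hjx.trans h)⟩

omit [Finite ι] [P.IsRootSystem] [P.IsCrystallographic] [P.IsReduced] in
theorem le_of_mem_subquiver {p y : Fin k} (hy : y ∈ subquiver b β Set.univ {p}) :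
    QuiverLE b β Set.univ p y := by
  obtain ⟨q, hq, hqy⟩ := exists_peak_le β y
  by_cases h : q = p
  · rwa [← h]
  · exact absurd hqy (hy.2 q ⟨hq, h⟩)

omit [Finite ι] [P.IsRootSystem] [P.IsCrystallographic] [P.IsReduced] in
theorem peak_mem_subquiver {p : Fin k} (hp : p ∈ peaks b β Set.univ) :
    p ∈ subquiver b β Set.univ {p} :=
  ⟨trivial, fun j hj hjp => hj.2 (hp.2 j trivial hjp)⟩

omit [Finite ι] [P.IsRootSystem] [P.IsCrystallographic] [P.IsReduced] in
theorem exists_positions_subquiver_eq_cons {p : Fin k} (hp : p ∈ peaks b β Set.univ) :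
    ∃ l, positions (subquiver b β Set.univ {p}) = p :: l := by
  obtain ⟨A, B, hAB⟩ := List.append_of_mem (mem_positions.mpr (peak_mem_subquiver hp))
  have hA : A = [] := by
    rw [List.eq_nil_iff_forall_not_mem]
    intro a ha
    obtain ⟨h1, h2⟩ := ((mem_and_lt_of_positions_eq hAB).1 a).mp ha
    exact absurd h2 (not_lt.mpr (le_of_mem_subquiver h1).le)
  exact ⟨B, by rw [hAB, hA, List.nil_append]⟩

omit [Finite ι] [P.IsRootSystem] [P.IsCrystallographic] [P.IsReduced] in
theorem grows_positions_subquiver (p : Fin k) :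
    Grows b ((positions (subquiver b β Set.univ {p})).map β) := by
  intro A' c B' h hne
  obtain ⟨A, C, hAC, rfl, hC⟩ := List.map_eq_append_iff.mp h
  obtain ⟨z, B, rfl, rfl, rfl⟩ := List.map_eq_cons_iff.mp hC
  have hmem := (mem_and_lt_of_positions_eq hAC).1
  have hz : z ∈ subquiver b β Set.univ {p} := mem_positions.mp (by rw [hAC]; simp)
  rcases Relation.ReflTransGen.cases_tail (le_of_mem_subquiver hz) with h | ⟨u, hu, huz⟩
  · obtain ⟨a, ha⟩ := List.exists_mem_of_ne_nil A (by simpa using hne)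
    obtain ⟨h1, h2⟩ := (hmem a).mp ha
    exact absurd h2 (not_lt.mpr (h ▸ (le_of_mem_subquiver h1).le))
  · refine ⟨β u, List.mem_map_of_mem ((hmem u).mpr ⟨?_, huz.2.2.2.1⟩), huz.2.2.1⟩
    exact mem_subquiver_of_le (Relation.ReflTransGen.single huz) hz

end Finite


section Finite

variable [Finite ι] [P.IsRootSystem] [P.IsCrystallographic] [P.IsReduced]
  {k : ℕ} {β : Fin k → b.support}

/-- Let `x` be a nonnegative combination of simple roots, supported on the labels of the vertices
above the peak `p` and no other peak, and orthogonal to the labels of all other vertices. If all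
maximal vertices have the same label, then there are no other vertices. -/
theorem subquiver_eq_univ (hβ : IsReducedWord b ((List.finRange k).map β)) {p : Fin k}
    (hp : p ∈ peaks b β Set.univ)
    (hmax : ∀ m m' : Fin k, (∀ z, QuiverLE b β Set.univ m z → z = m) →
      (∀ z, QuiverLE b β Set.univ m' z → z = m') → β m = β m')
    {x : V} (hx : ∀ d : b.support, 0 ≤ coord b d x)
    (hsupp : ∀ d, 0 < coord b d x ↔ ∃ y ∈ subquiver b β Set.univ {p}, β y = d)
    (horth : ∀ y ∉ subquiver b β Set.univ {p}, P.toLinearMap x (P.coroot (β y)) = 0) :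
    subquiver b β Set.univ {p} = Set.univ := by
  by_contra hne
  obtain ⟨v, hv⟩ := (Set.ne_univ_iff_exists_notMem _).mp hne
  -- There is a second peak `q`, below `v`.
  obtain ⟨q, hq, hqp, hqv⟩ : ∃ q ∈ peaks b β Set.univ, q ≠ p ∧ QuiverLE b β Set.univ q v := by
    by_contra! h
    exact hv ⟨trivial, fun j hj hjv => h j hj.1 hj.2 hjv⟩
  have hnot : ∀ z, QuiverLE b β Set.univ q z → z ∉ subquiver b β Set.univ {p} :=
    fun z hz hmem => hmem.2 q ⟨hq, hqp⟩ hz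
  -- Outside of the subquiver, a label linked to the support of `x` lies in this support.
  have hlink : ∀ y ∉ subquiver b β Set.univ {p}, ∀ d, 0 < coord b d x →
      P.pairing d (β y) ≠ 0 → 0 < coord b (β y) x := by
    intro y hy d hd hdy
    by_contra h0
    have := toLinearMap_coroot_neg hx (le_antisymm (not_lt.mp h0) (hx _)) hd hdy
    exact this.ne (horth y hy)
  have hup : ∀ y z, QuiverLE b β Set.univ y z → 0 < coord b (β y) x → 0 < coord b (β z) x := by
    intro y z hyz hy
    induction hyz with
    | refl => exact hy
    | @tail u z _ huz ih =>
      by_cases hz : z ∈ subquiver b β Set.univ {p}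
      · exact (hsupp _).mpr ⟨z, hz, rfl⟩
      · exact hlink z hz _ ih huz.2.2.1
  have hdown : ∀ z, QuiverLE b β Set.univ q z → 0 < coord b (β z) x → 0 < coord b (β q) x := by
    intro z hz
    induction hz with
    | refl => exact id
    | @tail u z hqu huz ih =>
      intro h
      exact ih (hlink u (hnot u hqu) _ h fun h0 => huz.2.2.1 (P.pairing_eq_zero_iff.mp h0))
  obtain ⟨m, hpm, hm⟩ := exists_maximal_ge β p
  obtain ⟨m', hqm', hm'⟩ := exists_maximal_ge β q
  have h1 := hup p m hpm ((hsupp _).mpr ⟨p, peak_mem_subquiver hp, rfl⟩)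
  rw [hmax m m' hm hm'] at h1
  -- So the label of `q` occurs among the labels over `p`; but vertices with the same label are
  -- comparable.
  obtain ⟨u, hu, huq⟩ := (hsupp _).mp (hdown m' hqm' h1)
  have hself : P.pairing (β q) (β q) ≠ 0 := by simp
  rcases lt_trichotomy u q with h | h | h
  · exact h.ne (hq.2 u trivial (quiverLE_of_lt hβ h (by rw [huq]; exact hself)))
  · exact hnot q Relation.ReflTransGen.refl (h ▸ hu)
  · exact hnot u (quiverLE_of_lt hβ h (by rw [huq]; exact hself)) hu

end Finite

end MinusculeE

open MinusculeE RootPairing in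
theorem proposition4p16 {ι V V' : Type*} [Finite ι]
    [AddCommGroup V] [Module ℚ V] [AddCommGroup V'] [Module ℚ V']
    (P : RootPairing ι ℚ V V') [P.IsRootSystem] [P.IsCrystallographic] [P.IsReduced]
    (b : P.Base) (hE : MinusculeE.IsTypeE6 b ∨ MinusculeE.IsTypeE7 b)
    (I : Set b.support) (hI : MinusculeE.IsMinusculeParabolic b I)
    (w : P.weylGroup) (hw : w ∈ MinusculeE.minimalReps b I)
    (k : ℕ) (β : Fin k → b.support) (hβ : MinusculeE.IsReducedDecomposition b w β)
    (order : List (Fin k)) (horder : MinusculeE.IsPeakOrdering b β order)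
    (w₁ : P.weylGroup) (ws : List P.weylGroup)
    (hdec : MinusculeE.constructionOne b β order = w₁ :: ws) :
    ∃ α : b.support,
      (∀ γ : b.support, MinusculeE.IsNegRoot b (w₁⁻¹ • P.root (γ : ι)) ↔ γ = α) ∧
      MinusculeE.Dominates b (w₁⁻¹ • P.root (α : ι)) (w⁻¹ • P.root (α : ι)) ∧
      (w₁⁻¹ • P.root (α : ι) = w⁻¹ • P.root (α : ι) ↔ w = w₁) ∧
      (w = w₁ ↔ (w₁ :: ws).length = 1) := by
  obtain ⟨ϖ, hϖ1, hϖ2⟩ := hI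
  match order with
  | [] => simp [constructionOne, constructionOneAux] at hdec
  | p :: is =>
  have hlen : ws.length = is.length := by
    have := length_constructionOneAux (b := b) β Set.univ (p :: is)
    rw [← constructionOne, hdec] at this
    simpa using this
  set Q := subquiver b β Set.univ {p} with hQdef
  have hw₁ : w₁ = reflProd b ((positions Q).map β) := by
    simp only [constructionOne, constructionOneAux, List.cons.injEq] at hdec
    rw [← subwordProd_eq, ← hdec.1]
  have hp : p ∈ peaks b β Set.univ := (horder.2 p).mp List.mem_cons_self
  have hred := hβ.isReducedWord
  set L₂ := (positions Qᶜ).map β with hL₂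
  obtain ⟨l, hl⟩ := exists_positions_subquiver_eq_cons hp
  set L₁ := l.map β with hL₁
  have hQL : (positions Q).map β = β p :: L₁ := by rw [hl, List.map_cons]
  have hgrow : Grows b (β p :: L₁) := hQL ▸ grows_positions_subquiver p
  -- The word of `Q` followed by the word of its complement is again a reduced word of `w`.
  have hprod : reflProd b ((β p :: L₁) ++ L₂) = w := by
    rw [reflProd_append, ← hQL, hL₂, reflProd_positions_mul hred fun x y h hy =>
      mem_subquiver_of_le h hy, ← wordProd_eq, hβ.1]
  have hred' : IsReducedWord b ((β p :: L₁) ++ L₂) := by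
    intro M hM
    have h1 := hred M (by rw [hM, hprod, ← wordProd_eq, hβ.1])
    have h2 := length_positions_add Q
    rw [← hQL, List.length_append, hL₂]
    simp only [List.length_map, List.length_finRange] at h1 ⊢
    omega
  have hmin := isMinuscule_of_fundamental hϖ1 hϖ2
  have hlow : Lowers b ϖ ((β p :: L₁) ++ L₂) :=
    lowers_of_mem_minimalReps hϖ1 hϖ2 hred' (by rwa [hprod])
  have hlow₀ : Lowers b ϖ ((List.finRange k).map β) :=
    lowers_of_mem_minimalReps hϖ1 hϖ2 hred (by rwa [← wordProd_eq, hβ.1])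
  rw [hQL] at hw₁
  have hww : w = w₁ * reflProd b L₂ := by rw [← hprod, hw₁, reflProd_append]
  have hcoord := coord_neg_inv_smul L₁ (fun A c B h =>
    hlow.nonneg hmin (A := A) (c := c) (B := B ++ L₂) (by
      change (β p :: L₁) ++ L₂ = _; rw [h]; simp)) hgrow
  rw [← hw₁] at hcoord
  have hwroot : w⁻¹ • P.root (β p) =
      (reflProd b L₂)⁻¹ • P.root (P.weylGroupToPerm w₁⁻¹ (β p)) := by
    rw [hww, mul_inv_rev, mul_smul, weylGroup_apply_root]
  obtain ⟨hdom, -, horth⟩ := dominates_inv_smul (b := b) L₂ (P.weylGroupToPerm w₁⁻¹ (β p)) (by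
    intro A c B h
    have := hlow.nonneg hmin (A := (β p :: L₁) ++ A) (c := c) (B := B) (by
      change (β p :: L₁) ++ L₂ = _; rw [h]; simp)
    rwa [reflProd_append, ← hw₁, mul_inv_rev, mul_smul, weylGroup_apply_root (P := P) w₁⁻¹] at this)
  -- The equality `w = w₁` means that `Q` consists of all vertices, as the word `L₁ L₂` is reduced.
  have huniv : Q = Set.univ → w = w₁ := by
    intro h
    have h2 : L₂ = [] := by simp [hL₂, h, positions]
    rw [hww, h2, reflProd_nil, mul_one]
  have huniv' : w = w₁ → Q = Set.univ := by
    intro h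
    have h1 := hred' (β p :: L₁) (by rw [hprod, h, hw₁])
    have h2 : L₂ = [] := by
      rw [← List.length_eq_zero_iff]
      rw [List.length_append] at h1
      omega
    rw [hL₂, List.map_eq_nil_iff] at h2
    refine Set.eq_univ_of_forall fun x => ?_
    by_contra hx
    have : x ∈ positions Qᶜ := mem_positions.mpr hx
    simp [h2] at this
  refine ⟨β p, fun γ => ⟨fun h => ?_, ?_⟩, ?_, ⟨fun h => ?_, fun h => by rw [h]⟩,
    ⟨fun h => ?_, fun h => huniv ?_⟩⟩
  · rw [weylGroup_apply_root, isNegRoot_root_iff, hw₁] at h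
    exact eq_head_of_not_isPos (hlow.left) hgrow h
  · rintro rfl
    rw [weylGroup_apply_root, isNegRoot_root_iff]
    intro hpos
    have h1 := coord_nonneg_of_isPos hpos (β p)
    have h2 := (hcoord (β p)).2.mpr List.mem_cons_self
    rw [weylGroup_apply_root, map_neg] at h2
    linarith
  · rw [hwroot, weylGroup_apply_root]
    exact hdom
  · rw [hwroot, weylGroup_apply_root] at h
    refine huniv (subquiver_eq_univ hred hp (fun m m' hm hm' => ?_)
      (x := -(w₁⁻¹ • P.root (β p))) (fun d => (hcoord d).1) (fun d => ?_) fun y hy => ?_)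
    · exact eq_of_notMem hE hϖ1 hϖ2 (notMem_of_maximal hϖ1 hred hlow₀ hm)
        (notMem_of_maximal hϖ1 hred hlow₀ hm')
    · rw [(hcoord d).2, ← hQL, List.mem_map]
      simp only [mem_positions, hQdef]
    · rw [weylGroup_apply_root, map_neg, LinearMap.neg_apply, root_coroot_eq_pairing,
        horth h.symm (β y) (List.mem_map_of_mem (mem_positions.mpr hy)), neg_zero]
  · have h1 := huniv' h
    rw [List.length_cons, hlen, Nat.add_eq_right, List.length_eq_zero_iff,
      List.eq_nil_iff_forall_not_mem]
    intro j hj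
    have hjp : j ≠ p := by
      rintro rfl
      exact (List.nodup_cons.mp horder.1).1 hj
    have hjQ : j ∈ Q := h1 ▸ Set.mem_univ j
    exact hjQ.2 j ⟨(horder.2 j).mp (List.mem_cons_of_mem p hj), hjp⟩ Relation.ReflTransGen.refl
  · rw [List.length_cons, hlen, Nat.add_eq_right, List.length_eq_zero_iff] at h
    refine Set.eq_univ_of_forall fun x => ⟨trivial, fun j hj _ => hj.2 ?_⟩
    have := (horder.2 j).mpr hj.1
    rw [h] at this
    simpa using this
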